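/- Consider a system of a local server of capacity $\mu_0>0$ and a cloud server of capacity $K\mu_0$, $K>1$. Jobs arrive at a base queue according to a Poisson process of rate $\lambda>0$. Each job is eventually assigned to one of two service modes: under SM1 it receives an exponential service of rate $\mu_{c1}=K\mu_0$ at the cloud; under SM2 it receives first an exponential service of rate $\mu_{l2}=\mu_0/f$ at the local server and then an exponential service of rate $\mu_{c2}=K\mu_0/(1-f)$ at the cloud, where $0<f<1$. All interarrival and service times are independent, the servers are non-idling, and the cloud serves SM2 jobs with (preemptive) priority over SM1 jobs. The state is $s=(n_0,i_2,i_1,n_2)\in\mathbb N_0\times\{0,1\}^2\times\mathbb N_0$: the number of jobs in the base queue, the number of jobs at the local server, the number of SM1 jobs at the cloud and the number of SM2 jobs at the cloud; $n(s)=n_0+i_2+i_1+n_2$. At time $0$ and at each arrival or service completion a controller acts. A policy $\pi$ is a map from states to actions: $\mathtt{idle}$ (always admissible), $\mathtt{SM1}$ (admissible if $n_0\ge 1$ and $i_1=0$; it changes $s$ to $(n_0-1,i_2,1,n_2)$), or $\mathtt{SM2}$ (admissible if $n_0\ge 1$ and $i_2=0$; it changes $s$ to $(n_0-1,1,i_1,n_2)$).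 Actions are carried out at once, and the controller goes on acting at the same instant, according to $\pi$ in the new state, until it idles. If one job is assigned to SM1 and one to SM2 in immediate succession, SM1 is picked first; that is, $\pi(s)=\mathtt{SM2}$ implies $\pi(n_0-1,1,i_1,n_2)\neq\mathtt{SM1}$. For a discount factor $\beta>0$ let $$J_\beta(s_0;\pi)=\mathbb E_\pi\Big[\int_0^\infty e^{-\beta t}\,n(s(t))\,dt\;\Big|\;s(0)=s_0\Big],\qquad V_\beta(s_0)=\inf_\pi J_\beta(s_0;\pi),$$ and call $\pi^*$ delay-optimal if $J_\beta(s_0;\pi^*)=V_\beta(s_0)$ for all states $s_0$. **Theorem (cloud-first behaviour).** Assume $f>1/K$, equivalently $\mu_{c1}>\mu_{l2}$. Then every delay-optimal policy $\pi^*$ is cloud-first: $\pi^*(s)=\mathtt{SM1}$ for every state $s=(n_0,i_2,i_1,n_2)$ with $n_0\ge 1$ and $i_1=n_2=0$. -/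

import Mathlib

open MeasureTheory ProbabilityTheory
open scoped ENNReal

namespace Offloading

/-- Parameters of the two-server offloading system: the local server has capacity `μ₀`, the cloud
server has capacity `K * μ₀`, a fraction `f` of an SM2 job is processed locally, and jobs arrive
according to a Poisson process of rate `lam`. -/
structure Params where
  /-- capacity of the local server -/
  μ₀ : ℝ
  /-- ratio of the capacity of the cloud server to that of the local server -/
  K : ℝ
  /-- fraction of an SM2 job that is processed at the local server -/
  f : ℝ
  /-- arrival rate -/
  lam : ℝ
  μ₀_pos : 0 < μ₀
  one_lt_K : 1 < K
  f_pos : 0 < f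
  f_lt_one : f < 1
  lam_pos : 0 < lam

/-- Rate of the cloud service of an SM1 job. -/
noncomputable def Params.μc1 (P : Params) : ℝ := P.K * P.μ₀

/-- Rate of the local service of an SM2 job. -/
noncomputable def Params.μl2 (P : Params) : ℝ := P.μ₀ / P.f

/-- Rate of the cloud service of an SM2 job. -/
noncomputable def Params.μc2 (P : Params) : ℝ := P.K * P.μ₀ / (1 - P.f)

/-- A state `(n₀, i₂, i₁, n₂)` of the system. -/
@[ext]
structure State where
  /-- number of jobs in the base queue -/
  n0 : ℕ
  /-- whether an SM2 job is in service at the local server -/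
  i2 : Bool
  /-- whether an SM1 job is at the cloud (waiting or in service) -/
  i1 : Bool
  /-- number of SM2 jobs at the cloud -/
  n2 : ℕ

/-- The (countable) state space carries the discrete σ-algebra. -/
instance : MeasurableSpace State := ⊤

/-- Total number of jobs in the system. -/
def State.jobs (s : State) : ℕ := s.n0 + s.i2.toNat + s.i1.toNat + s.n2

/-- Control actions of the dynamic mode selector. -/
inductive Action where
  | idle
  | SM1
  | SM2

/-- Admissible actions: SM1 needs a job in the base queue and no SM1 job at the cloud; SM2 needs a
job in the base queue and no job at the local server. -/
def Action.Admissible (s : State) : Action → Prop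
  | .idle => True
  | .SM1 => 1 ≤ s.n0 ∧ s.i1 = false
  | .SM2 => 1 ≤ s.n0 ∧ s.i2 = false

/-- The state reached from `s` by carrying out an action at once. -/
def Action.apply : Action → State → State
  | .idle, s => s
  | .SM1, s => { s with n0 := s.n0 - 1, i1 := true }
  | .SM2, s => { s with n0 := s.n0 - 1, i2 := true }

/-- A stationary Markov policy. The field `sm1_first` is the convention that, whenever a policy
assigns one job to SM2 and one job to SM1 in immediate succession, SM1 is picked first. -/
structure Policy where
  /-- the action chosen in each state -/
  act : State → Action
  admissible : ∀ s, (act s).Admissible s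
  sm1_first : ∀ s, act s = .SM2 → act (Action.SM2.apply s) ≠ .SM1

/-- Carry out the action of the policy in a state. -/
def Policy.step (π : Policy) (s : State) : State := (π.act s).apply s

/-- The state after the policy has acted, at one instant, until it idles. At most two assignments
can be made in immediate succession, see `Policy.act_settle`. -/
def Policy.settle (π : Policy) (s : State) : State := π.step (π.step s)

theorem Policy.act_settle (π : Policy) (s : State) : π.act (π.settle s) = .idle := by
  have h0 := π.admissible s
  have h1 := π.admissible (π.step s)
  have h2 := π.admissible (π.settle s)
  unfold settle at *
  cases ha : π.act s with
  | idle => simp [step, ha, Action.apply]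
  | SM1 =>
    have e1 : π.step s = { s with n0 := s.n0 - 1, i1 := true } := by simp [step, ha, Action.apply]
    cases hb : π.act (π.step s) with
    | idle =>
      have e2 : π.step (π.step s) = π.step s := by
        conv_lhs => rw [step, hb]
        rfl
      rw [e2, hb]
    | SM1 => rw [hb, e1] at h1; simp [Action.Admissible] at h1
    | SM2 =>
      have e2 : π.step (π.step s) = { s with n0 := s.n0 - 1 - 1, i1 := true, i2 := true } := by
        conv_lhs => rw [step, hb]
        rw [e1]; rfl
      rw [e2] at h2 ⊢
      cases hc : π.act { s with n0 := s.n0 - 1 - 1, i1 := true, i2 := true } <;>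
        simp_all [Action.Admissible]
  | SM2 =>
    have e1 : π.step s = { s with n0 := s.n0 - 1, i2 := true } := by simp [step, ha, Action.apply]
    cases hb : π.act (π.step s) with
    | idle =>
      have e2 : π.step (π.step s) = π.step s := by
        conv_lhs => rw [step, hb]
        rfl
      rw [e2, hb]
    | SM2 => rw [hb, e1] at h1; simp [Action.Admissible] at h1
    | SM1 =>
      have e2 : π.step (π.step s) = { s with n0 := s.n0 - 1 - 1, i1 := true, i2 := true } := by
        conv_lhs => rw [step, hb]
        rw [e1]; rfl
      rw [e2] at h2 ⊢
      cases hc : π.act { s with n0 := s.n0 - 1 - 1, i1 := true, i2 := true } <;>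
        simp_all [Action.Admissible]

/-- The random transitions of the system. -/
inductive Event where
  | arrival
  | localDone
  | cloudSM1Done
  | cloudSM2Done

instance : MeasurableSpace Event := ⊤

/-- The state reached from `s` by an event (before the policy acts). -/
def Event.next : Event → State → State
  | .arrival, s => { s with n0 := s.n0 + 1 }
  | .localDone, s => { s with i2 := false, n2 := s.n2 + s.i2.toNat }
  | .cloudSM1Done, s => { s with i1 := false }
  | .cloudSM2Done, s => { s with n2 := s.n2 - 1 }

/-- The rate at which an event occurs in state `s`. The servers are non-idling, and the cloud
gives priority to SM2 jobs: an SM1 job is served there only if no SM2 job is present. -/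
noncomputable def Params.rate (P : Params) (s : State) : Event → ℝ
  | .arrival => P.lam
  | .localDone => if s.i2 = true then P.μl2 else 0
  | .cloudSM1Done => if s.i1 = true ∧ s.n2 = 0 then P.μc1 else 0
  | .cloudSM2Done => if 1 ≤ s.n2 then P.μc2 else 0

/-- Total rate of leaving state `s`. -/
noncomputable def Params.exitRate (P : Params) (s : State) : ℝ :=
  P.rate s .arrival + P.rate s .localDone + P.rate s .cloudSM1Done + P.rate s .cloudSM2Done

theorem Params.rate_nonneg (P : Params) (s : State) (e : Event) : 0 ≤ P.rate s e := by
  have h0 := P.μ₀_pos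
  have h1 := P.one_lt_K
  have h2 := P.f_pos
  have h3 := P.f_lt_one
  have h4 := P.lam_pos
  have h5 : 0 < 1 - P.f := by linarith
  have h6 : 0 < P.K := by linarith
  cases e <;> simp only [rate, μl2, μc1, μc2] <;> (try split_ifs) <;> positivity

theorem Params.exitRate_pos (P : Params) (s : State) : 0 < P.exitRate s := by
  have h1 : 0 < P.rate s .arrival := P.lam_pos
  have h2 := P.rate_nonneg s .localDone
  have h3 := P.rate_nonneg s .cloudSM1Done
  have h4 := P.rate_nonneg s .cloudSM2Done
  unfold exitRate
  linarith

/-- Law of the event that ends a stay in state `s`: each event has probability proportional to its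
rate. -/
noncomputable def Params.eventLaw (P : Params) (s : State) : Measure Event :=
  ENNReal.ofReal (P.rate s .arrival / P.exitRate s) • Measure.dirac .arrival
  + ENNReal.ofReal (P.rate s .localDone / P.exitRate s) • Measure.dirac .localDone
  + ENNReal.ofReal (P.rate s .cloudSM1Done / P.exitRate s) • Measure.dirac .cloudSM1Done
  + ENNReal.ofReal (P.rate s .cloudSM2Done / P.exitRate s) • Measure.dirac .cloudSM2Done

instance (P : Params) (s : State) : IsProbabilityMeasure (P.eventLaw s) := by
  constructor
  have hr := P.exitRate_pos s
  have h (e : Event) : 0 ≤ P.rate s e / P.exitRate s := div_nonneg (P.rate_nonneg s e) hr.le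
  simp only [Params.eventLaw, Measure.coe_add, Measure.coe_smul, Pi.add_apply, Pi.smul_apply,
    measure_univ, smul_eq_mul, mul_one]
  rw [← ENNReal.ofReal_add (h _) (h _), ← ENNReal.ofReal_add (add_nonneg (h _) (h _)) (h _),
    ← ENNReal.ofReal_add (add_nonneg (add_nonneg (h _) (h _)) (h _)) (h _), ← add_div, ← add_div,
    ← add_div]
  rw [show P.rate s .arrival + P.rate s .localDone + P.rate s .cloudSM1Done
    + P.rate s .cloudSM2Done = P.exitRate s from rfl, div_self hr.ne', ENNReal.ofReal_one]

/-- Joint law of the length of a stay in state `s`, exponential with the total rate, and of the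
event that ends it, independent of the length. -/
noncomputable def Params.stayLaw (P : Params) (s : State) : Measure (ℝ × Event) :=
  (expMeasure (P.exitRate s)).prod (P.eventLaw s)

instance (P : Params) (s : State) : IsProbabilityMeasure (P.stayLaw s) := by
  have := isProbabilityMeasure_expMeasure (P.exitRate_pos s)
  unfold Params.stayLaw
  infer_instance

/-- Sample space: `ω k s` holds the length of, and the event ending, the `k`-th stay of the
process if that stay is spent in state `s`. -/
abbrev Sample : Type := ℕ → State → ℝ × Event

/-- All entries `ω k s` of a sample are independent, and `ω k s` has law `P.stayLaw s`. -/
noncomputable def Params.sampleLaw (P : Params) : Measure Sample :=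
  Measure.infinitePi fun _ : ℕ => Measure.infinitePi fun s : State => P.stayLaw s

/-- The state occupied during the `k`-th stay, under the policy `π` from the initial state `s₀`.
The policy acts at time `0` and right after each event. -/
def chain (π : Policy) (s₀ : State) (ω : Sample) : ℕ → State
  | 0 => π.settle s₀
  | k + 1 => π.settle ((ω k (chain π s₀ ω k)).2.next (chain π s₀ ω k))

/-- The time at which the `k`-th stay starts. -/
noncomputable def jumpTime (π : Policy) (s₀ : State) (ω : Sample) (k : ℕ) : ℝ :=
  ∑ j ∈ Finset.range k, (ω j (chain π s₀ ω j)).1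

/-- The number `n(t)` of jobs in the system at time `t`: it equals the number of jobs in the
`k`-th state of the chain for `t` between the `k`-th and the `k+1`-st jump times. -/
noncomputable def jobsAt (π : Policy) (s₀ : State) (ω : Sample) (t : ℝ) : ℝ≥0∞ :=
  ∑' k : ℕ, (Set.Ico (jumpTime π s₀ ω k) (jumpTime π s₀ ω (k + 1))).indicator
    (fun _ => ((chain π s₀ ω k).jobs : ℝ≥0∞)) t

/-- The discounted cost-to-go `E [∫₀^∞ exp (-β t) n(t) dt]` of the policy `π` from `s₀`. -/
noncomputable def Params.cost (P : Params) (β : ℝ) (s₀ : State) (π : Policy) : ℝ≥0∞ :=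
  ∫⁻ ω, (∫⁻ t in Set.Ici (0 : ℝ), ENNReal.ofReal (Real.exp (-β * t)) * jobsAt π s₀ ω t)
    ∂P.sampleLaw

/-- The value function. -/
noncomputable def Params.value (P : Params) (β : ℝ) (s₀ : State) : ℝ≥0∞ :=
  ⨅ π : Policy, P.cost β s₀ π

/-- A policy is delay-optimal if its cost-to-go equals the value function in every initial
state. -/
def Params.DelayOptimal (P : Params) (β : ℝ) (π : Policy) : Prop :=
  ∀ s₀ : State, P.cost β s₀ π = P.value β s₀

/-- A policy is cloud-first if it assigns SM1 in every state with a nonempty base queue and an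
empty cloud. -/
def Policy.CloudFirst (π : Policy) : Prop :=
  ∀ s : State, 1 ≤ s.n0 → s.i1 = false → s.n2 = 0 → π.act s = .SM1

end Offloading

namespace Offloading

/-! ### The uniformized Bellman operator -/

/-! Uniformization makes all states comparable term by term. Every state gets an arrival clock, a
local clock and a cloud clock; the cloud clock is split into rate `μc1`, serving whichever job has
priority there, and surplus rate `μc2 - μc1`, serving SM2 jobs only. A tick with nothing to serve
leaves the state unchanged (`Params.flow_eq`).

By policy improvement (`Params.DelayOptimal.le_idleCost`) the cost `V` of a delay-optimal policy is
a fixed point of the resulting Bellman operator, attained by the policy itself. A weighted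
contraction makes `V` the limit of value iteration from `0`, so `V` inherits every closed system of
inequalities that the operator preserves. That system is `Ordered`.

Its central member is `sm1_le_base`: moving a waiting job to an empty cloud does not hurt. The hard
case is a busy local server, whose completion puts a priority job ahead of the job just committed to
SM1. The inequality `commit` bounds the resulting loss by `V (n,1,1,0) - V (n,1,0,0)`, hence by `V
(n+1,1,0,0) - V (n,1,0,0)`. This loss occurs at rate `μl2`, while a cloud completion gains that same
last difference at rate `μc1`. A surplus `μc1 - μl2 > 0` times the difference remains.

An extra job strictly raises the cost, so the surplus is strictly positive. Hence idling with an
empty cloud is strictly worse than SM1 (`lt_flow_base`), as is sending the only job to the local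
server (`lt_flow_loc`). This rules out the alternatives for every optimal policy. -/

/-- `Reach s s'` holds if a controller in state `s` can bring the system to `s'` at once. -/
inductive Reach : State → State → Prop
  | refl (s : State) : Reach s s
  | sm1 (n : ℕ) (j : Bool) (m : ℕ) : Reach ⟨n + 1, j, false, m⟩ ⟨n, j, true, m⟩
  | sm2 (n : ℕ) (i : Bool) (m : ℕ) : Reach ⟨n + 1, false, i, m⟩ ⟨n, true, i, m⟩
  | both (n m : ℕ) : Reach ⟨n + 2, false, false, m⟩ ⟨n, true, true, m⟩

theorem Reach.trans {s t u : State} (h₁ : Reach s t) (h₂ : Reach t u) : Reach s u := by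
  cases h₁ <;> cases h₂ <;> constructor

theorem Reach.jobs_eq {s t : State} (h : Reach s t) : t.jobs = s.jobs := by
  cases h <;> simp only [State.jobs, Bool.toNat_true, Bool.toNat_false] <;> ring

/-- The state after a completion at the cloud. -/
def cloudDone : State → State
  | ⟨n, j, _, 0⟩ => ⟨n, j, false, 0⟩
  | ⟨n, j, i, m + 1⟩ => ⟨n, j, i, m⟩

theorem jobs_cloudDone_le (s : State) : (cloudDone s).jobs ≤ s.jobs := by
  obtain ⟨n, j, i, _ | m⟩ := s <;> simp [cloudDone, State.jobs]

/-- Discount rate plus the rate of the uniformized transitions. -/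
noncomputable def Params.clock (P : Params) (β : ℝ) : ℝ := β + (P.lam + P.μl2 + P.μc2)

/-- Cost rate in state `s` plus the rates of the uniformized transitions weighted by `V`. -/
noncomputable def Params.flow (P : Params) (V : State → ℝ) (s : State) : ℝ :=
  s.jobs + P.lam * V (Event.arrival.next s) + P.μl2 * V (Event.localDone.next s)
    + P.μc1 * V (cloudDone s) + (P.μc2 - P.μc1) * V (Event.cloudSM2Done.next s)

/-- `V'` is the image of `V` under the uniformized Bellman operator. -/
structure Params.BellmanStep (P : Params) (β : ℝ) (V V' : State → ℝ) : Prop where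
  le : ∀ {s s'}, Reach s s' → P.clock β * V' s ≤ P.flow V s'
  eq : ∀ s, ∃ s', Reach s s' ∧ P.clock β * V' s = P.flow V s'

theorem Params.μl2_pos (P : Params) : 0 < P.μl2 := div_pos P.μ₀_pos P.f_pos

theorem Params.μc1_pos (P : Params) : 0 < P.μc1 :=
  mul_pos (by linarith [P.one_lt_K]) P.μ₀_pos

theorem Params.μc1_lt_μc2 (P : Params) : P.μc1 < P.μc2 := by
  have h1 := P.μc1_pos
  have h2 := P.f_pos
  have h3 := P.f_lt_one
  unfold μc2
  rw [lt_div_iff₀ (by linarith)]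
  change P.μc1 * _ < P.μc1
  nlinarith

theorem Params.μl2_lt_μc1 (P : Params) (hf : 1 / P.K < P.f) : P.μl2 < P.μc1 := by
  have h1 := P.μ₀_pos
  have h2 := P.one_lt_K
  unfold μl2 μc1
  rw [div_lt_iff₀ P.f_pos]
  rw [div_lt_iff₀ (by linarith)] at hf
  nlinarith

theorem Params.clock_pos (P : Params) {β : ℝ} (hβ : 0 < β) : 0 < P.clock β := by
  have := P.lam_pos
  have := P.μl2_pos
  have := P.μc1_pos
  have := P.μc1_lt_μc2
  unfold clock
  linarith

/-! ### Inequalities preserved by the Bellman operator -/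

/-- The inequalities between values of neighbouring states that the Bellman operator preserves. -/
structure Ordered (V : State → ℝ) : Prop where
  base : ∀ n j i m, V ⟨n, j, i, m⟩ ≤ V ⟨n + 1, j, i, m⟩
  sm1 : ∀ n j m, V ⟨n, j, false, m⟩ ≤ V ⟨n, j, true, m⟩
  loc : ∀ n i m, V ⟨n, false, i, m⟩ ≤ V ⟨n, true, i, m⟩
  cloud : ∀ n j i m, V ⟨n, j, i, m⟩ ≤ V ⟨n, j, i, m + 1⟩
  progress : ∀ n i m, V ⟨n, false, i, m + 1⟩ ≤ V ⟨n, true, i, m⟩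
  cloud_le_loc : ∀ n, V ⟨n, false, true, 0⟩ ≤ V ⟨n, true, false, 0⟩
  sm1_le_base : ∀ n j, V ⟨n, j, true, 0⟩ ≤ V ⟨n + 1, j, false, 0⟩
  commit : ∀ n, V ⟨n, false, true, 1⟩ + V ⟨n, true, false, 0⟩ ≤
    V ⟨n + 1, false, false, 1⟩ + V ⟨n, true, true, 0⟩

/-! ### Comparison of neighbouring states event by event, before minimization -/

section Flow

variable {P : Params} {V : State → ℝ}

theorem Ordered.flow_base (h : Ordered V) (n j i m) :
    P.flow V ⟨n, j, i, m⟩ + 1 ≤ P.flow V ⟨n + 1, j, i, m⟩ := by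
  have ha := P.lam_pos.le
  have hl := P.μl2_pos.le
  have hc := P.μc1_pos.le
  have hd := sub_nonneg.2 P.μc1_lt_μc2.le
  have e1 := mul_le_mul_of_nonneg_left (h.base (n + 1) j i m) ha
  have e2 := mul_le_mul_of_nonneg_left (h.base n false i (m + j.toNat)) hl
  have e4 := mul_le_mul_of_nonneg_left (h.base n j i (m - 1)) hd
  rcases m with _ | m
  · have e3 := mul_le_mul_of_nonneg_left (h.base n j false 0) hc
    simp [Params.flow, State.jobs, Event.next, cloudDone] at *
    linarith
  · have e3 := mul_le_mul_of_nonneg_left (h.base n j i m) hc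
    simp [Params.flow, State.jobs, Event.next, cloudDone] at *
    linarith

theorem Ordered.flow_sm1 (h : Ordered V) (n j m) :
    P.flow V ⟨n, j, false, m⟩ + 1 ≤ P.flow V ⟨n, j, true, m⟩ := by
  have ha := P.lam_pos.le
  have hl := P.μl2_pos.le
  have hc := P.μc1_pos.le
  have hd := sub_nonneg.2 P.μc1_lt_μc2.le
  have e1 := mul_le_mul_of_nonneg_left (h.sm1 (n + 1) j m) ha
  have e2 := mul_le_mul_of_nonneg_left (h.sm1 n false (m + j.toNat)) hl
  have e4 := mul_le_mul_of_nonneg_left (h.sm1 n j (m - 1)) hd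
  rcases m with _ | m
  · simp [Params.flow, State.jobs, Event.next, cloudDone] at *
    linarith
  · have e3 := mul_le_mul_of_nonneg_left (h.sm1 n j m) hc
    simp [Params.flow, State.jobs, Event.next, cloudDone] at *
    linarith

theorem Ordered.flow_loc (h : Ordered V) (n i m) :
    P.flow V ⟨n, false, i, m⟩ + 1 ≤ P.flow V ⟨n, true, i, m⟩ := by
  have ha := P.lam_pos.le
  have hl := P.μl2_pos.le
  have hc := P.μc1_pos.le
  have hd := sub_nonneg.2 P.μc1_lt_μc2.le
  have e1 := mul_le_mul_of_nonneg_left (h.loc (n + 1) i m) ha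
  have e2 := mul_le_mul_of_nonneg_left (h.cloud n false i m) hl
  have e4 := mul_le_mul_of_nonneg_left (h.loc n i (m - 1)) hd
  rcases m with _ | m
  · have e3 := mul_le_mul_of_nonneg_left (h.loc n false 0) hc
    simp [Params.flow, State.jobs, Event.next, cloudDone] at *
    linarith
  · have e3 := mul_le_mul_of_nonneg_left (h.loc n i m) hc
    simp [Params.flow, State.jobs, Event.next, cloudDone] at *
    linarith

theorem Ordered.flow_cloud (h : Ordered V) (n j i m) :
    P.flow V ⟨n, j, i, m⟩ + 1 ≤ P.flow V ⟨n, j, i, m + 1⟩ := by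
  have ha := P.lam_pos.le
  have hl := P.μl2_pos.le
  have hc := P.μc1_pos.le
  have hd := sub_nonneg.2 P.μc1_lt_μc2.le
  have e1 := mul_le_mul_of_nonneg_left (h.cloud (n + 1) j i m) ha
  have e2 := mul_le_mul_of_nonneg_left (h.cloud n false i (m + j.toNat)) hl
  rw [add_right_comm] at e2
  rcases m with _ | m
  · have e3 : P.μc1 * V ⟨n, j, false, 0⟩ ≤ P.μc1 * V ⟨n, j, i, 0⟩ := by
      cases i
      · rfl
      · exact mul_le_mul_of_nonneg_left (h.sm1 n j 0) hc
    simp [Params.flow, State.jobs, Event.next, cloudDone] at *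
    linarith
  · have e3 := mul_le_mul_of_nonneg_left (h.cloud n j i m) hc
    have e4 := mul_le_mul_of_nonneg_left (h.cloud n j i m) hd
    simp [Params.flow, State.jobs, Event.next, cloudDone] at *
    linarith

theorem Ordered.flow_progress (h : Ordered V) (n i m) :
    P.flow V ⟨n, false, i, m + 1⟩ ≤ P.flow V ⟨n, true, i, m⟩ := by
  have ha := P.lam_pos.le
  have hl := P.μl2_pos.le
  have hc := P.μc1_pos.le
  have hd := sub_nonneg.2 P.μc1_lt_μc2.le
  have e1 := mul_le_mul_of_nonneg_left (h.progress (n + 1) i m) ha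
  rcases m with _ | m
  · have e4 := mul_le_mul_of_nonneg_left (h.loc n i 0) hd
    -- Priority separates the two sides: the left cloud completes its SM2 job, the right one its SM1
    -- job. For `i = true` this is what makes `cloud_le_loc` part of the system.
    have e3 : P.μc1 * V ⟨n, false, i, 0⟩ ≤ P.μc1 * V ⟨n, true, false, 0⟩ := by
      cases i
      · exact mul_le_mul_of_nonneg_left (h.loc n false 0) hc
      · exact mul_le_mul_of_nonneg_left (h.cloud_le_loc n) hc
    simp [Params.flow, State.jobs, Event.next, cloudDone] at *
    linarith
  · have e3 := mul_le_mul_of_nonneg_left (h.progress n i m) hc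
    have e4 := mul_le_mul_of_nonneg_left (h.progress n i m) hd
    simp [Params.flow, State.jobs, Event.next, cloudDone] at *
    linarith

/-- The local and cloud ticks are paired crosswise: a local tick leaves the left state unchanged and
still leaves an SM2 job on the right, while a slow cloud tick clears the left job only. The loss at
rate `μl2` is thus at most the gain made at rate `μc1`; the surplus is kept for the strict
inequality later. -/
theorem Ordered.flow_cloud_le_loc (h : Ordered V) (n) :
    P.flow V ⟨n, false, true, 0⟩
      + (P.μc1 - P.μl2) * (V ⟨n, true, false, 0⟩ - V ⟨n, false, false, 0⟩)
      ≤ P.flow V ⟨n, true, false, 0⟩ := by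
  have ha := P.lam_pos.le
  have hl := P.μl2_pos.le
  have hd := sub_nonneg.2 P.μc1_lt_μc2.le
  have e1 := mul_le_mul_of_nonneg_left (h.cloud_le_loc (n + 1)) ha
  have e2 := mul_le_mul_of_nonneg_left (h.cloud_le_loc n) hl
  have e3 := mul_le_mul_of_nonneg_left (h.cloud n false false 0) hl
  have e4 := mul_le_mul_of_nonneg_left (h.cloud_le_loc n) hd
  simp [Params.flow, State.jobs, Event.next, cloudDone] at *
  linarith

/-- Only the left side profits from a slow cloud tick, by `V (n+1,j,0,0) - V (n,j,0,0)`. For `j =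
true` a local tick may cause a loss, which `commit` followed by `sm1_le_base` bounds by the same
difference. -/
theorem Ordered.flow_sm1_le_base (h : Ordered V) (n j) :
    P.flow V ⟨n, j, true, 0⟩
      + (P.μc1 - P.μl2) * (V ⟨n + 1, j, false, 0⟩ - V ⟨n, j, false, 0⟩)
      ≤ P.flow V ⟨n + 1, j, false, 0⟩ := by
  have ha := P.lam_pos.le
  have hl := P.μl2_pos.le
  have hd := sub_nonneg.2 P.μc1_lt_μc2.le
  have e1 := mul_le_mul_of_nonneg_left (h.sm1_le_base (n + 1) j) ha
  have e4 := mul_le_mul_of_nonneg_left (h.sm1_le_base n j) hd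
  cases j
  · have e2 := mul_le_mul_of_nonneg_left (h.sm1_le_base n false) hl
    have e3 := mul_le_mul_of_nonneg_left (h.base n false false 0) hl
    simp [Params.flow, State.jobs, Event.next, cloudDone] at *
    linarith
  · have e2 := mul_le_mul_of_nonneg_left (h.commit n) hl
    have e3 := mul_le_mul_of_nonneg_left (h.sm1_le_base n true) hl
    simp [Params.flow, State.jobs, Event.next, cloudDone] at *
    linarith

/-- This closes the system without comparing rates: after a local tick two of the four states
coincide and `base` remains; after a slow cloud tick two coincide and `sm1_le_base` remains; after a
surplus tick `sm1_le_base` and `sm1` add up. -/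
theorem Ordered.flow_commit (h : Ordered V) (n) :
    P.flow V ⟨n, false, true, 1⟩ + P.flow V ⟨n, true, false, 0⟩ ≤
      P.flow V ⟨n + 1, false, false, 1⟩ + P.flow V ⟨n, true, true, 0⟩ := by
  have ha := P.lam_pos.le
  have hl := P.μl2_pos.le
  have hc := P.μc1_pos.le
  have hd := sub_nonneg.2 P.μc1_lt_μc2.le
  have e1 := mul_le_mul_of_nonneg_left (h.commit (n + 1)) ha
  have e2 := mul_le_mul_of_nonneg_left (h.base n false false 1) hl
  have e3 := mul_le_mul_of_nonneg_left (h.sm1_le_base n false) hc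
  have e4 := mul_le_mul_of_nonneg_left (h.sm1_le_base n false) hd
  have e5 := mul_le_mul_of_nonneg_left (h.sm1 n true 0) hd
  simp [Params.flow, State.jobs, Event.next, cloudDone] at *
  linarith

end Flow

/-! ### Preservation under minimization, by imitating the minimizer of the larger side -/

section Step

variable {P : Params} {β : ℝ} {V V' : State → ℝ}

theorem Params.BellmanStep.le_of_reach (hB : P.BellmanStep β V V') (hβ : 0 < β) {s t : State}
    (h : Reach s t) : V' s ≤ V' t := by
  obtain ⟨u, hu, e⟩ := hB.eq t
  have := hB.le (h.trans hu)
  rw [← e] at this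
  exact le_of_mul_le_mul_left this (P.clock_pos hβ)

/-- The smaller state copies the minimizer of the larger one, omitting one assignment when it lacks
the job for it. The extra job's cost rate is the `1`, which makes a fixed point strictly increasing.
-/
theorem Ordered.step_base (h : Ordered V) (hB : P.BellmanStep β V V') (n j i m) :
    P.clock β * V' ⟨n, j, i, m⟩ + 1 ≤ P.clock β * V' ⟨n + 1, j, i, m⟩ := by
  obtain ⟨x, hx, e⟩ := hB.eq ⟨n + 1, j, i, m⟩
  rw [e]
  cases hx with
  | refl => linarith [hB.le (.refl ⟨n, j, i, m⟩), h.flow_base (P := P) n j i m]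
  | sm1 =>
    cases n with
    | zero => linarith [hB.le (.refl ⟨0, j, false, m⟩), h.flow_sm1 (P := P) 0 j m]
    | succ k => linarith [hB.le (.sm1 k j m), h.flow_base (P := P) k j true m]
  | sm2 =>
    cases n with
    | zero => linarith [hB.le (.refl ⟨0, false, i, m⟩), h.flow_loc (P := P) 0 i m]
    | succ k => linarith [hB.le (.sm2 k i m), h.flow_base (P := P) k true i m]
  | both k =>
    cases k with
    | zero => linarith [hB.le (.sm1 0 false m), h.flow_loc (P := P) 0 true m]
    | succ k => linarith [hB.le (.both k m), h.flow_base (P := P) k true true m]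

theorem Ordered.step_sm1 (h : Ordered V) (hB : P.BellmanStep β V V') (n j m) :
    P.clock β * V' ⟨n, j, false, m⟩ + 1 ≤ P.clock β * V' ⟨n, j, true, m⟩ := by
  obtain ⟨x, hx, e⟩ := hB.eq ⟨n, j, true, m⟩
  rw [e]
  cases hx with
  | refl => linarith [hB.le (.refl ⟨n, j, false, m⟩), h.flow_sm1 (P := P) n j m]
  | sm2 k => linarith [hB.le (.sm2 k false m), h.flow_sm1 (P := P) k true m]

theorem Ordered.step_loc (h : Ordered V) (hB : P.BellmanStep β V V') (n i m) :
    P.clock β * V' ⟨n, false, i, m⟩ + 1 ≤ P.clock β * V' ⟨n, true, i, m⟩ := by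
  obtain ⟨x, hx, e⟩ := hB.eq ⟨n, true, i, m⟩
  rw [e]
  cases hx with
  | refl => linarith [hB.le (.refl ⟨n, false, i, m⟩), h.flow_loc (P := P) n i m]
  | sm1 k => linarith [hB.le (.sm1 k false m), h.flow_loc (P := P) k true m]

theorem Ordered.step_cloud (h : Ordered V) (hB : P.BellmanStep β V V') (n j i m) :
    P.clock β * V' ⟨n, j, i, m⟩ + 1 ≤ P.clock β * V' ⟨n, j, i, m + 1⟩ := by
  obtain ⟨x, hx, e⟩ := hB.eq ⟨n, j, i, m + 1⟩
  rw [e]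
  cases hx with
  | refl => linarith [hB.le (.refl ⟨n, j, i, m⟩), h.flow_cloud (P := P) n j i m]
  | sm1 k => linarith [hB.le (.sm1 k j m), h.flow_cloud (P := P) k j true m]
  | sm2 k => linarith [hB.le (.sm2 k i m), h.flow_cloud (P := P) k true i m]
  | both k => linarith [hB.le (.both k m), h.flow_cloud (P := P) k true true m]

theorem Ordered.step_progress (h : Ordered V) (hB : P.BellmanStep β V V') (n i m) :
    P.clock β * V' ⟨n, false, i, m + 1⟩ ≤ P.clock β * V' ⟨n, true, i, m⟩ := by
  obtain ⟨x, hx, e⟩ := hB.eq ⟨n, true, i, m⟩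
  rw [e]
  cases hx with
  | refl => linarith [hB.le (.refl ⟨n, false, i, m + 1⟩), h.flow_progress (P := P) n i m]
  | sm1 k => linarith [hB.le (.sm1 k false (m + 1)), h.flow_progress (P := P) k true m]

theorem Ordered.step_cloud_le_loc (h : Ordered V) (hB : P.BellmanStep β V V')
    (hf : 1 / P.K < P.f) (n) :
    P.clock β * V' ⟨n, false, true, 0⟩ ≤ P.clock β * V' ⟨n, true, false, 0⟩ := by
  obtain ⟨x, hx, e⟩ := hB.eq ⟨n, true, false, 0⟩
  rw [e]
  cases hx with
  | refl =>
    have := mul_nonneg (sub_nonneg.2 (P.μl2_lt_μc1 hf).le) (sub_nonneg.2 (h.loc n false 0))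
    linarith [hB.le (.refl ⟨n, false, true, 0⟩), h.flow_cloud_le_loc (P := P) n]
  | sm1 k => exact hB.le (.sm2 k true 0)

theorem Ordered.step_sm1_le_base (h : Ordered V) (hB : P.BellmanStep β V V')
    (hf : 1 / P.K < P.f) (n j) :
    P.clock β * V' ⟨n, j, true, 0⟩ ≤ P.clock β * V' ⟨n + 1, j, false, 0⟩ := by
  have hlc := sub_nonneg.2 (P.μl2_lt_μc1 hf).le
  obtain ⟨x, hx, e⟩ := hB.eq ⟨n + 1, j, false, 0⟩
  rw [e]
  cases hx with
  | refl =>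
    have := mul_nonneg hlc (sub_nonneg.2 (h.base n j false 0))
    linarith [hB.le (.refl ⟨n, j, true, 0⟩), h.flow_sm1_le_base (P := P) n j]
  | sm1 => exact hB.le (.refl _)
  | sm2 =>
    -- The minimizer fills the local server but not the cloud. A single job is compared across the
    -- servers; with a further job the left side fills its local server too, and the case `j = true`
    -- applies.
    cases n with
    | zero =>
      have := mul_nonneg hlc (sub_nonneg.2 (h.loc 0 false 0))
      linarith [hB.le (.refl ⟨0, false, true, 0⟩), h.flow_cloud_le_loc (P := P) 0]
    | succ k =>
      have := mul_nonneg hlc (sub_nonneg.2 (h.base k true false 0))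
      linarith [hB.le (.sm2 k true 0), h.flow_sm1_le_base (P := P) k true]
  | both k => exact hB.le (.sm2 k true 0)

theorem Ordered.step_commit (h : Ordered V) (hB : P.BellmanStep β V V') (n) :
    P.clock β * V' ⟨n, false, true, 1⟩ + P.clock β * V' ⟨n, true, false, 0⟩ ≤
      P.clock β * V' ⟨n + 1, false, false, 1⟩ + P.clock β * V' ⟨n, true, true, 0⟩ := by
  obtain ⟨x, hx, e⟩ := hB.eq ⟨n + 1, false, false, 1⟩
  obtain ⟨y, hy, e'⟩ := hB.eq ⟨n, true, true, 0⟩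
  have hM := h.step_sm1 hB n true 0
  rw [e, e'] at *
  -- In `(n,1,1,0)` both servers are taken, so its minimizer is the state itself.
  cases hy with
  | refl =>
  cases hx with
  | refl =>
    linarith [hB.le (.refl ⟨n, false, true, 1⟩), hB.le (.refl ⟨n, true, false, 0⟩),
      h.flow_commit (P := P) n]
  | sm1 => linarith [hB.le (.refl ⟨n, false, true, 1⟩)]
  -- The partners are exchanged: `(n,0,1,1)` is compared with `(n,1,1,0)`, and `(n,1,0,0)` with the
  -- minimizer `(n,1,0,1)`.
  | sm2 =>
    linarith [hB.le (.refl ⟨n, false, true, 1⟩), hB.le (.refl ⟨n, true, false, 0⟩),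
      h.flow_progress (P := P) n true 0, h.flow_cloud (P := P) n true false 0]
  | both k => linarith [hB.le (.sm2 k true 1)]

theorem Ordered.step (h : Ordered V) (hB : P.BellmanStep β V V') (hβ : 0 < β)
    (hf : 1 / P.K < P.f) : Ordered V' := by
  have hκ := P.clock_pos hβ
  have key {x y : ℝ} (hxy : P.clock β * x ≤ P.clock β * y) : x ≤ y :=
    le_of_mul_le_mul_left hxy hκ
  refine ⟨fun n j i m => key ?_, fun n j m => key ?_, fun n i m => key ?_, fun n j i m => key ?_,
    fun n i m => key ?_, fun n => key ?_, fun n j => key ?_, fun n => key ?_⟩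
  · linarith [h.step_base hB n j i m]
  · linarith [h.step_sm1 hB n j m]
  · linarith [h.step_loc hB n i m]
  · linarith [h.step_cloud hB n j i m]
  · exact h.step_progress hB n i m
  · exact h.step_cloud_le_loc hB hf n
  · exact h.step_sm1_le_base hB hf n j
  · rw [mul_add, mul_add]
    exact h.step_commit hB n

end Step

/-! ### Value iteration -/

theorem finite_setOf_reach (s : State) : {t | Reach s t}.Finite := by
  refine (Set.toFinite {s, Action.SM1.apply s, Action.SM2.apply s,
    Action.SM2.apply (Action.SM1.apply s)}).subset ?_
  intro t ht
  cases (ht : Reach s t) <;> simp [Action.apply]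

theorem exists_reach_min {α : Type*} [LinearOrder α] (W : State → α) (s : State) :
    ∃ u, Reach s u ∧ ∀ t, Reach s t → W u ≤ W t :=
  Set.exists_min_image _ W (finite_setOf_reach s) ⟨s, .refl s⟩

theorem Params.exists_bellmanStep (P : Params) {β : ℝ} (hβ : 0 < β) (V : State → ℝ) :
    ∃ V', P.BellmanStep β V V' := by
  choose u hu hmin using exists_reach_min (P.flow V)
  have hκ := P.clock_pos hβ
  refine ⟨fun s => P.flow V (u s) / P.clock β, ⟨fun {s t} h => ?_, fun s => ⟨u s, hu s, ?_⟩⟩⟩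
  · rw [mul_div_cancel₀ _ hκ.ne']
    exact hmin s t h
  · rw [mul_div_cancel₀ _ hκ.ne']

theorem ordered_zero : Ordered fun _ => 0 := by
  constructor <;> intros <;> simp

theorem Params.flow_mono (P : Params) {U V : State → ℝ} (h : ∀ s, U s ≤ V s) (s : State) :
    P.flow U s ≤ P.flow V s := by
  have e1 := mul_le_mul_of_nonneg_left (h (Event.arrival.next s)) P.lam_pos.le
  have e2 := mul_le_mul_of_nonneg_left (h (Event.localDone.next s)) P.μl2_pos.le
  have e3 := mul_le_mul_of_nonneg_left (h (cloudDone s)) P.μc1_pos.le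
  have e4 := mul_le_mul_of_nonneg_left (h (Event.cloudSM2Done.next s))
    (sub_nonneg.2 P.μc1_lt_μc2.le)
  unfold flow
  linarith

theorem jobs_localDone (s : State) : (Event.localDone.next s).jobs = s.jobs := by
  simp [Event.next, State.jobs]
  ring

theorem jobs_cloudSM2Done_le (s : State) : (Event.cloudSM2Done.next s).jobs ≤ s.jobs := by
  simp [Event.next, State.jobs]

theorem jobs_arrival (s : State) : (Event.arrival.next s).jobs = s.jobs + 1 := by
  simp [Event.next, State.jobs]
  ring

/-- Contraction in a weighted norm. Only an arrival raises the weight, at total rate `lam`; the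
constant `2 * lam / β` is chosen so that this consumes at most half of the discount. -/
theorem Params.flow_sub_le (P : Params) {β : ℝ} (hβ : 0 < β) {U V : State → ℝ} {c : ℝ}
    (hc : 0 ≤ c) (h : ∀ s, V s - U s ≤ c * (s.jobs + 2 * P.lam / β)) (s : State) :
    P.flow V s - P.flow U s ≤ c * ((P.clock β - β / 2) * (s.jobs + 2 * P.lam / β)) := by
  have hmono {t : State} (ht : t.jobs ≤ s.jobs) :
      V t - U t ≤ c * (s.jobs + 2 * P.lam / β) := by
    refine (h t).trans (mul_le_mul_of_nonneg_left ?_ hc)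
    have : (t.jobs : ℝ) ≤ s.jobs := by exact_mod_cast ht
    linarith
  have h1 := h (Event.arrival.next s)
  rw [jobs_arrival] at h1
  push_cast at h1
  have e1 := mul_le_mul_of_nonneg_left h1 P.lam_pos.le
  have e2 := mul_le_mul_of_nonneg_left (hmono (jobs_localDone s).le) P.μl2_pos.le
  have e3 := mul_le_mul_of_nonneg_left (hmono (jobs_cloudDone_le s)) P.μc1_pos.le
  have e4 := mul_le_mul_of_nonneg_left (hmono (jobs_cloudSM2Done_le s))
    (sub_nonneg.2 P.μc1_lt_μc2.le)
  have h5 : β / 2 * (2 * P.lam / β) = P.lam := by field_simp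
  have h6 : 0 ≤ c * (β / 2 * s.jobs) := by positivity
  have h7 : c * (β / 2 * (2 * P.lam / β)) = c * P.lam := by rw [h5]
  unfold flow clock
  linarith

/-- A fixed point of the Bellman operator of at most linear growth is ordered. -/
theorem Params.BellmanStep.ordered {P : Params} {β : ℝ} {V : State → ℝ} (hV : P.BellmanStep β V V)
    (hβ : 0 < β) (hf : 1 / P.K < P.f) (h0 : ∀ s, 0 ≤ V s) {c : ℝ} (hc : 0 ≤ c)
    (hle : ∀ s, V s ≤ c * (s.jobs + 2 * P.lam / β)) : Ordered V := by
  choose T hT using P.exists_bellmanStep hβ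
  have hκ := P.clock_pos hβ
  set U : ℕ → State → ℝ := fun k => T^[k] fun _ => 0 with hU
  have hstep (k : ℕ) : P.BellmanStep β (U k) (U (k + 1)) := by
    simp only [hU, Function.iterate_succ_apply']
    exact hT _
  have hord (k : ℕ) : Ordered (U k) := by
    induction k with
    | zero => exact ordered_zero
    | succ k ih => exact ih.step (hstep k) hβ hf
  -- Started from `0`, the iterates stay below `V` by monotonicity, so only the upper gap `V - U k`
  -- needs the contraction.
  have hUV (k : ℕ) : ∀ s, U k s ≤ V s := by
    induction k with
    | zero => exact h0
    | succ k ih =>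
      intro s
      obtain ⟨u, hu, e⟩ := hV.eq s
      refine le_of_mul_le_mul_left ?_ hκ
      rw [e]
      exact ((hstep k).le hu).trans (P.flow_mono ih u)
  set γ : ℝ := (P.clock β - β / 2) / P.clock β with hγ
  have hκβ : β < P.clock β := by
    have := P.lam_pos
    have := P.μl2_pos
    have := P.μc1_pos.trans P.μc1_lt_μc2
    unfold clock
    linarith
  have hγ0 : 0 ≤ γ := div_nonneg (by linarith) hκ.le
  have hγ1 : γ < 1 := by
    rw [hγ, div_lt_one hκ]
    linarith
  have hgap (k : ℕ) : ∀ s, V s - U k s ≤ c * γ ^ k * (s.jobs + 2 * P.lam / β) := by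
    induction k with
    | zero => simpa [hU] using hle
    | succ k ih =>
      intro s
      obtain ⟨u, hu, e⟩ := (hstep k).eq s
      have h1 := P.flow_sub_le hβ (by positivity) ih u
      rw [hu.jobs_eq, ← e] at h1
      have h2 := hV.le hu
      refine le_of_mul_le_mul_left ?_ hκ
      have h3 : P.clock β * γ = P.clock β - β / 2 := mul_div_cancel₀ _ hκ.ne'
      calc P.clock β * (V s - U (k + 1) s)
          ≤ c * γ ^ k * ((P.clock β * γ) * (s.jobs + 2 * P.lam / β)) := by
            rw [h3]
            linarith
        _ = _ := by ring
  have hlim (s : State) : Filter.Tendsto (fun k => U k s) Filter.atTop (nhds (V s)) := by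
    have h1 : Filter.Tendsto (fun k => V s - c * γ ^ k * (s.jobs + 2 * P.lam / β))
        Filter.atTop (nhds (V s)) := by
      have := ((tendsto_pow_atTop_nhds_zero_of_lt_one hγ0 hγ1).const_mul c).mul_const
        (s.jobs + 2 * P.lam / β)
      simpa using this.const_sub (V s)
    exact tendsto_of_tendsto_of_tendsto_of_le_of_le h1 tendsto_const_nhds
      (fun k => by linarith [hgap k s]) fun k => hUV k s
  refine ⟨fun n j i m => ?_, fun n j m => ?_, fun n i m => ?_, fun n j i m => ?_,
    fun n i m => ?_, fun n => ?_, fun n j => ?_, fun n => ?_⟩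
  · exact le_of_tendsto_of_tendsto' (hlim _) (hlim _) fun k => (hord k).base n j i m
  · exact le_of_tendsto_of_tendsto' (hlim _) (hlim _) fun k => (hord k).sm1 n j m
  · exact le_of_tendsto_of_tendsto' (hlim _) (hlim _) fun k => (hord k).loc n i m
  · exact le_of_tendsto_of_tendsto' (hlim _) (hlim _) fun k => (hord k).cloud n j i m
  · exact le_of_tendsto_of_tendsto' (hlim _) (hlim _) fun k => (hord k).progress n i m
  · exact le_of_tendsto_of_tendsto' (hlim _) (hlim _) fun k => (hord k).cloud_le_loc n
  · exact le_of_tendsto_of_tendsto' (hlim _) (hlim _) fun k => (hord k).sm1_le_base n j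
  · exact le_of_tendsto_of_tendsto' ((hlim _).add (hlim _)) ((hlim _).add (hlim _))
      fun k => (hord k).commit n

/-! ### Idling with an empty cloud is suboptimal -/

section Strict

variable {P : Params} {β : ℝ} {V : State → ℝ}

/-- Keeping the cloud empty while there are jobs in the base queue is suboptimal. -/
theorem Params.BellmanStep.lt_flow_base (hV : P.BellmanStep β V V) (h : Ordered V) (hβ : 0 < β)
    (hf : 1 / P.K < P.f) (n j) :
    P.clock β * V ⟨n + 1, j, false, 0⟩ < P.flow V ⟨n + 1, j, false, 0⟩ := by
  have h1 := hV.le (.sm1 n j 0)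
  have h2 := h.flow_sm1_le_base (P := P) n j
  have h3 : V ⟨n, j, false, 0⟩ < V ⟨n + 1, j, false, 0⟩ :=
    lt_of_mul_lt_mul_left (by linarith [h.step_base hV n j false 0]) (P.clock_pos hβ).le
  linarith [mul_pos (sub_pos.2 (P.μl2_lt_μc1 hf)) (sub_pos.2 h3)]

/-- Assigning the only job in the system to SM2 is suboptimal. -/
theorem Params.BellmanStep.lt_flow_loc (hV : P.BellmanStep β V V) (h : Ordered V) (hβ : 0 < β)
    (hf : 1 / P.K < P.f) :
    P.clock β * V ⟨1, false, false, 0⟩ < P.flow V ⟨0, true, false, 0⟩ := by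
  have h1 := hV.le (.sm1 0 false 0)
  have h2 := h.flow_cloud_le_loc (P := P) 0
  have h3 : V ⟨0, false, false, 0⟩ < V ⟨0, true, false, 0⟩ :=
    lt_of_mul_lt_mul_left (by linarith [h.step_loc hV 0 false 0]) (P.clock_pos hβ).le
  linarith [mul_pos (sub_pos.2 (P.μl2_lt_μc1 hf)) (sub_pos.2 h3)]

/-- A policy that attains the minimum in the Bellman equation is cloud-first. -/
theorem Params.BellmanStep.cloudFirst (hV : P.BellmanStep β V V) (hβ : 0 < β)
    (hf : 1 / P.K < P.f) (h : Ordered V) (π : Policy)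
    (hπ : ∀ s, P.clock β * V s = P.flow V (π.settle s)) : π.CloudFirst := by
  rintro ⟨n, j, i, m⟩ hn hi hm
  obtain ⟨n, rfl⟩ : ∃ k, n = k + 1 := ⟨n - 1, (Nat.sub_add_cancel hn).symm⟩
  obtain rfl : i = false := hi
  obtain rfl : m = 0 := hm
  have hs := hπ ⟨n + 1, j, false, 0⟩
  cases ha : π.act ⟨n + 1, j, false, 0⟩ with
  | SM1 => rfl
  | idle =>
    have e : π.step ⟨n + 1, j, false, 0⟩ = ⟨n + 1, j, false, 0⟩ := by
      simp [Policy.step, ha, Action.apply]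
    rw [Policy.settle, e, e] at hs
    exact absurd hs (hV.lt_flow_base h hβ hf n j).ne
  | SM2 =>
    obtain rfl : j = false := by
      simpa [ha, Action.Admissible] using π.admissible ⟨n + 1, j, false, 0⟩
    have e : π.step ⟨n + 1, false, false, 0⟩ = ⟨n, true, false, 0⟩ := by
      simp [Policy.step, ha, Action.apply]
    -- The SM1-first convention excludes SM1 here and the busy local server excludes SM2, so the
    -- policy settles with an empty cloud.
    have h1 : π.act ⟨n, true, false, 0⟩ ≠ .SM1 := π.sm1_first _ ha
    have e' : π.step ⟨n, true, false, 0⟩ = ⟨n, true, false, 0⟩ := by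
      have h2 := π.admissible ⟨n, true, false, 0⟩
      cases hb : π.act ⟨n, true, false, 0⟩ with
      | SM1 => exact absurd hb h1
      | idle => simp [Policy.step, hb, Action.apply]
      | SM2 => simp [hb, Action.Admissible] at h2
    rw [Policy.settle, e, e'] at hs
    cases n with
    | zero => exact absurd hs (hV.lt_flow_loc h hβ hf).ne
    | succ k =>
      have h3 := hV.lt_flow_base h hβ hf k true
      have h4 := mul_le_mul_of_nonneg_left (hV.le_of_reach hβ (.sm2 (k + 1) false 0))
        (P.clock_pos hβ).le
      linarith

end Strict

/-! ### Discounting and exponential times -/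

theorem lintegral_Ico_exp {β : ℝ} (hβ : 0 < β) (a b : ℝ) :
    ∫⁻ t in Set.Ico a b, ENNReal.ofReal (Real.exp (-β * t)) =
      ENNReal.ofReal ((Real.exp (-β * a) - Real.exp (-β * b)) / β) := by
  rcases le_or_gt a b with hab | hab
  · have hcont : Continuous fun t : ℝ => Real.exp (-β * t) := by fun_prop
    have hint : ∫ t in a..b, Real.exp (-β * t) =
        (Real.exp (-β * a) - Real.exp (-β * b)) / β := by
      rw [intervalIntegral.integral_comp_mul_left _ (neg_ne_zero.2 hβ.ne'), integral_exp]
      simp only [smul_eq_mul]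
      field_simp
      ring
    rw [setLIntegral_congr Ico_ae_eq_Ioc, ← hint, intervalIntegral.integral_of_le hab,
      ofReal_integral_eq_lintegral_ofReal]
    · exact (hcont.integrableOn_Icc (a := a) (b := b)).mono_set Set.Ioc_subset_Icc_self
    · exact Filter.Eventually.of_forall fun t => (Real.exp_pos _).le
  -- For `b < a` both sides vanish: the difference is negative and `ENNReal.ofReal` truncates it.
  · rw [Set.Ico_eq_empty (not_lt.2 hab.le), Measure.restrict_empty, lintegral_zero_measure,
      ENNReal.ofReal_of_nonpos]
    refine div_nonpos_of_nonpos_of_nonneg (sub_nonpos.2 (Real.exp_le_exp.2 ?_)) hβ.le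
    nlinarith

theorem expMeasure_ae_nonneg (r : ℝ) : ∀ᵐ x ∂expMeasure r, 0 ≤ x := by
  change ∀ᵐ x ∂(volume.withDensity (gammaPDF 1 r)), 0 ≤ x
  have hm : Measurable (gammaPDF 1 r) := (measurable_gammaPDFReal 1 r).ennreal_ofReal
  rw [ae_withDensity_iff hm]
  refine Filter.Eventually.of_forall fun x hx => ?_
  by_contra h
  exact hx (gammaPDF_of_neg (not_le.1 h))

/-- Discounting tilts the exponential density of rate `r` into `r / (β + r)` times that of rate `β +
r`. -/
theorem lintegral_exp_expMeasure {β r : ℝ} (hβ : 0 < β) (hr : 0 < r) :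
    ∫⁻ x, ENNReal.ofReal (Real.exp (-β * x)) ∂expMeasure r = ENNReal.ofReal (r / (β + r)) := by
  change ∫⁻ x, _ ∂(volume.withDensity (exponentialPDF r)) = _
  have hm (r : ℝ) : Measurable (exponentialPDF r) :=
    (measurable_exponentialPDFReal r).ennreal_ofReal
  rw [lintegral_withDensity_eq_lintegral_mul _ (hm r) (by fun_prop)]
  have h (x : ℝ) : (exponentialPDF r * fun x => ENNReal.ofReal (Real.exp (-β * x))) x =
      ENNReal.ofReal (r / (β + r)) * exponentialPDF (β + r) x := by
    rcases lt_or_ge x 0 with hx | hx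
    · simp [exponentialPDF_of_neg hx]
    · rw [Pi.mul_apply, exponentialPDF_of_nonneg hx, exponentialPDF_of_nonneg hx,
        ← ENNReal.ofReal_mul (by positivity), ← ENNReal.ofReal_mul (by positivity), mul_assoc,
        ← Real.exp_add, ← mul_assoc, div_mul_cancel₀ _ (by positivity)]
      congr 3
      ring
  simp_rw [h]
  rw [lintegral_const_mul _ (hm _), lintegral_exponentialPDF_eq_one (by positivity), mul_one]

/-- The integrand and `1 / β` times the discount factor add up to `1 / β` almost surely; the known,
finite integral of the latter is cancelled. -/
theorem lintegral_discounted_stay {β r : ℝ} (hβ : 0 < β) (hr : 0 < r) :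
    ∫⁻ x, ENNReal.ofReal ((1 - Real.exp (-β * x)) / β) ∂expMeasure r =
      ENNReal.ofReal (1 / (β + r)) := by
  have := isProbabilityMeasure_expMeasure hr
  have h1 : ∫⁻ x, (ENNReal.ofReal ((1 - Real.exp (-β * x)) / β)
      + ENNReal.ofReal (1 / β) * ENNReal.ofReal (Real.exp (-β * x))) ∂expMeasure r =
      ENNReal.ofReal (1 / β) := by
    have : ∀ᵐ x ∂expMeasure r, ENNReal.ofReal ((1 - Real.exp (-β * x)) / β)
      + ENNReal.ofReal (1 / β) * ENNReal.ofReal (Real.exp (-β * x)) = ENNReal.ofReal (1 / β) := by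
      filter_upwards [expMeasure_ae_nonneg r] with x hx
      have h2 : Real.exp (-β * x) ≤ 1 := Real.exp_le_one_iff.2 (by nlinarith)
      rw [← ENNReal.ofReal_mul (by positivity),
        ← ENNReal.ofReal_add (div_nonneg (by linarith) hβ.le) (by positivity)]
      congr 1
      ring
    rw [lintegral_congr_ae this]
    simp
  rw [lintegral_add_left (by fun_prop), lintegral_const_mul _ (by fun_prop),
    lintegral_exp_expMeasure hβ hr, ← ENNReal.ofReal_mul (by positivity)] at h1
  have h2 : ENNReal.ofReal (1 / (β + r)) + ENNReal.ofReal (1 / β * (r / (β + r))) =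
      ENNReal.ofReal (1 / β) := by
    rw [← ENNReal.ofReal_add (by positivity) (by positivity)]
    congr 1
    field_simp
  rw [← h2] at h1
  exact (ENNReal.add_left_inj ENNReal.ofReal_ne_top).1 h1

/-! ### Splitting off the first coordinate of a sequence of independent variables -/

theorem measurePreserving_eval_const {ι X : Type*} [MeasurableSpace X] (ν : Measure X)
    [IsProbabilityMeasure ν] (k : ι) :
    MeasurePreserving (fun ω : ι → X => ω k) (Measure.infinitePi fun _ : ι => ν) ν :=
  measurePreserving_eval_infinitePi (fun _ : ι => ν) k

/-- The inverse map, prepending a coordinate, is shown to be measure preserving by evaluating it on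
finite-dimensional boxes. -/
theorem map_head_tail_infinitePi {X : Type*} [MeasurableSpace X] (ν : Measure X)
    [IsProbabilityMeasure ν] :
    (Measure.infinitePi fun _ : ℕ => ν).map (fun ω => (ω 0, fun k => ω (k + 1))) =
      ν.prod (Measure.infinitePi fun _ : ℕ => ν) := by
  set cons : X × (ℕ → X) → ℕ → X := fun p k => Nat.casesOn k p.1 p.2 with hcons
  have hcons_meas : Measurable cons := by
    refine measurable_pi_lambda _ fun k => ?_
    cases k with
    | zero => exact measurable_fst
    | succ k => exact (measurable_pi_apply k).comp measurable_snd
  have hmap : (ν.prod (Measure.infinitePi fun _ : ℕ => ν)).map cons =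
      Measure.infinitePi fun _ : ℕ => ν := by
    refine Measure.eq_infinitePi _ fun s t ht => ?_
    classical
    obtain ⟨N, hN⟩ : ∃ N, s ⊆ Finset.range (N + 1) :=
      ⟨s.sup id, fun i hi => Finset.mem_range.2 (Nat.lt_succ_of_le (Finset.le_sup (f := id) hi))⟩
    -- Padding with `univ` turns an arbitrary finite index set into an initial segment, whose box
    -- splits into head and tail.
    set t' : ℕ → Set X := fun i => if i ∈ s then t i else Set.univ with ht'
    have ht'm (i : ℕ) : MeasurableSet (t' i) := by
      simp only [ht']
      split_ifs
      exacts [ht i, .univ]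
    have hpre : cons ⁻¹' (Set.pi s t) =
        t' 0 ×ˢ Set.pi (Finset.range N) (fun i => t' (i + 1)) := by
      ext p
      simp only [Set.mem_preimage, Set.mem_pi, Set.mem_prod, Finset.mem_coe, Finset.mem_range]
      constructor
      · intro h
        refine ⟨?_, fun i _ => ?_⟩
        · by_cases h0 : 0 ∈ s
          · rw [show t' 0 = t 0 from if_pos h0]
            exact h 0 h0
          · simp [ht', h0]
        · by_cases hi : i + 1 ∈ s
          · simpa [ht', hi] using h (i + 1) hi
          · simp [ht', hi]
      · rintro ⟨h0, h1⟩ i hi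
        cases i with
        | zero =>
          rw [show t' 0 = t 0 from if_pos hi] at h0
          exact h0
        | succ k =>
          have := h1 k (by simpa using hN hi)
          simpa [ht', hi] using this
    rw [Measure.map_apply hcons_meas (.pi s.countable_toSet fun i _ => ht i), hpre,
      Measure.prod_prod, Measure.infinitePi_pi _ fun i _ => ht'm _, mul_comm,
      ← Finset.prod_range_succ' (fun i => ν (t' i)), ← Finset.prod_subset hN]
    · exact Finset.prod_congr rfl fun i hi => by simp [ht', hi]
    · intro i _ hi
      simp [ht', hi]
  have hmeas : Measurable fun ω : ℕ → X => (ω 0, fun k => ω (k + 1)) := by fun_prop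
  conv_lhs => rw [← hmap]
  rw [Measure.map_map hmeas hcons_meas]
  exact Measure.map_id

/-! ### First-step analysis of the controlled process -/

instance : Countable State :=
  Function.Injective.countable (f := fun s : State => (s.n0, s.i2, s.i1, s.n2)) fun s t h => by
    simpa [State.ext_iff] using h

instance : DiscreteMeasurableSpace State := ⟨fun _ => trivial⟩

instance : Finite Event :=
  Finite.of_surjective
    (fun k : Fin 4 => ![Event.arrival, .localDone, .cloudSM1Done, .cloudSM2Done] k)
    fun e => by
      cases e
      exacts [⟨0, rfl⟩, ⟨1, rfl⟩, ⟨2, rfl⟩, ⟨3, rfl⟩]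

instance : DiscreteMeasurableSpace Event := ⟨fun _ => trivial⟩

/-- Joint law of the `k`-th stays in all states. -/
noncomputable def Params.stageLaw (P : Params) : Measure (State → ℝ × Event) :=
  Measure.infinitePi fun s : State => P.stayLaw s

instance (P : Params) : IsProbabilityMeasure P.stageLaw := by
  unfold Params.stageLaw
  infer_instance

theorem Params.sampleLaw_eq (P : Params) :
    P.sampleLaw = Measure.infinitePi fun _ : ℕ => P.stageLaw := rfl

instance (P : Params) : IsProbabilityMeasure P.sampleLaw := by
  rw [Params.sampleLaw_eq]
  infer_instance

theorem Params.measurePreserving_stage (P : Params) (s : State) :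
    MeasurePreserving (fun a : State → ℝ × Event => a s) P.stageLaw (P.stayLaw s) :=
  measurePreserving_eval_infinitePi (fun s : State => P.stayLaw s) s

/-- The sample of the stays after the first one. -/
def tail (ω : Sample) : Sample := fun k => ω (k + 1)

theorem measurable_const_pair (s : State) : Measurable fun ω : Sample => (s, ω) :=
  measurable_const.prodMk measurable_id

section FirstStep

variable (π : Policy)

theorem chain_succ_eq (s : State) (ω : Sample) (k : ℕ) :
    chain π s ω (k + 1) =
      chain π ((ω 0 (π.settle s)).2.next (π.settle s)) (tail ω) k := by
  induction k with
  | zero => rfl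
  | succ k ih =>
    rw [chain, ih]
    rfl

theorem jumpTime_succ_eq (s : State) (ω : Sample) (k : ℕ) :
    jumpTime π s ω (k + 1) = (ω 0 (π.settle s)).1 +
      jumpTime π ((ω 0 (π.settle s)).2.next (π.settle s)) (tail ω) k := by
  rw [jumpTime, Finset.sum_range_succ', add_comm]
  congr 1
  refine Finset.sum_congr rfl fun j _ => ?_
  rw [chain_succ_eq]
  rfl

theorem measurable_chain (k : ℕ) : Measurable fun p : State × Sample => chain π p.1 p.2 k := by
  induction k with
  | zero => exact (measurable_of_countable π.settle).comp measurable_fst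
  | succ k ih =>
    have h1 : Measurable fun p : State × (State → ℝ × Event) => (p.2 p.1).2 :=
      measurable_from_prod_countable_right fun s => by fun_prop
    have h2 : Measurable fun p : State × Sample => (p.2 k (chain π p.1 p.2 k)).2 :=
      h1.comp (ih.prodMk ((measurable_pi_apply k).comp measurable_snd))
    have h3 : Measurable fun q : State × Event => π.settle (q.2.next q.1) :=
      measurable_of_countable _
    exact h3.comp (ih.prodMk h2)

theorem measurable_jumpTime (k : ℕ) :
    Measurable fun p : State × Sample => jumpTime π p.1 p.2 k := by
  have h1 : Measurable fun p : State × (State → ℝ × Event) => (p.2 p.1).1 :=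
    measurable_from_prod_countable_right fun s => by fun_prop
  refine Finset.measurable_sum _ fun j _ => ?_
  exact h1.comp ((measurable_chain π j).prodMk ((measurable_pi_apply j).comp measurable_snd))

/-- Discounted cost of the `k`-th stay. -/
noncomputable def stayCost (β : ℝ) (s : State) (ω : Sample) (k : ℕ) : ℝ≥0∞ :=
  (chain π s ω k).jobs * ENNReal.ofReal
    ((Real.exp (-β * jumpTime π s ω k) - Real.exp (-β * jumpTime π s ω (k + 1))) / β)

theorem measurable_stayCost (β : ℝ) (k : ℕ) :
    Measurable fun p : State × Sample => stayCost π β p.1 p.2 k := by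
  have h1 := measurable_jumpTime π k
  have h2 := measurable_jumpTime π (k + 1)
  have h3 : Measurable fun s : State => (s.jobs : ℝ≥0∞) := measurable_of_countable _
  have h4 := h3.comp (measurable_chain π k)
  exact h4.mul (by fun_prop)

theorem stayCost_succ (β : ℝ) (s : State) (ω : Sample) (k : ℕ) :
    stayCost π β s ω (k + 1) = ENNReal.ofReal (Real.exp (-β * (ω 0 (π.settle s)).1)) *
      stayCost π β ((ω 0 (π.settle s)).2.next (π.settle s)) (tail ω) k := by
  rw [stayCost, stayCost, chain_succ_eq, jumpTime_succ_eq, jumpTime_succ_eq, mul_left_comm,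
    ← ENNReal.ofReal_mul (Real.exp_pos _).le]
  congr 2
  rw [mul_add, mul_add, Real.exp_add, Real.exp_add]
  ring

variable (P : Params) (β : ℝ)

/-- Expected discounted cost of the first `N` stays. -/
noncomputable def Params.partialCost (N : ℕ) (s : State) : ℝ≥0∞ :=
  ∫⁻ ω, ∑ k ∈ Finset.range N, stayCost π β s ω k ∂P.sampleLaw

theorem Params.ae_stay_nonneg : ∀ᵐ ω ∂P.sampleLaw, ∀ k s, 0 ≤ (ω k s).1 := by
  simp_rw [ae_all_iff]
  intro k s
  have h0 : MeasurePreserving (fun ω : Sample => ω k) P.sampleLaw P.stageLaw :=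
    measurePreserving_eval_const P.stageLaw k
  have h1 := P.measurePreserving_stage s
  have h2 : MeasurePreserving (fun p : ℝ × Event => p.1) (P.stayLaw s)
      (expMeasure (P.exitRate s)) := measurePreserving_fst
  exact ((h2.comp h1).comp h0).quasiMeasurePreserving.ae (expMeasure_ae_nonneg _)

/-- Stays have nonnegative length almost surely, so restricting to `t ≥ 0` cuts nothing off. All
terms are nonnegative, and non-explosion plays no role. -/
theorem Params.cost_eq_iSup {β : ℝ} (hβ : 0 < β) (s : State) :
    P.cost β s π = ⨆ N, P.partialCost π β N s := by
  have hstay (k : ℕ) := (measurable_stayCost π β k).comp (measurable_const_pair s)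
  simp only [Function.comp_def] at hstay
  have h1 : P.cost β s π = ∫⁻ ω, ∑' k, stayCost π β s ω k ∂P.sampleLaw := by
    refine lintegral_congr_ae ?_
    filter_upwards [P.ae_stay_nonneg] with ω hω
    have hT (k : ℕ) : 0 ≤ jumpTime π s ω k := Finset.sum_nonneg fun j _ => hω _ _
    simp only [jobsAt, ← ENNReal.tsum_mul_left]
    rw [lintegral_tsum fun k => ?_]
    · refine tsum_congr fun k => ?_
      rw [stayCost, ← lintegral_Ico_exp hβ, ← lintegral_const_mul _ (by fun_prop),
        ← lintegral_indicator measurableSet_Ici, ← lintegral_indicator measurableSet_Ico]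
      refine lintegral_congr fun t => ?_
      by_cases ht : t ∈ Set.Ico (jumpTime π s ω k) (jumpTime π s ω (k + 1))
      · have ht0 : t ∈ Set.Ici (0 : ℝ) := (hT k).trans ht.1
        simp only [Set.indicator_of_mem ht, Set.indicator_of_mem ht0]
        rw [mul_comm]
      · simp [Set.indicator_of_notMem ht]
    · exact (Measurable.mul (by fun_prop)
        (measurable_const.indicator measurableSet_Ico)).aemeasurable
  rw [h1, lintegral_tsum fun k => (hstay k).aemeasurable, ENNReal.tsum_eq_iSup_nat]
  refine iSup_congr fun N => ?_
  rw [partialCost, lintegral_finsetSum _ fun k _ => hstay k]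

theorem Params.partialCost_mono {M N : ℕ} (h : M ≤ N) (s : State) :
    P.partialCost π β M s ≤ P.partialCost π β N s :=
  lintegral_mono fun _ => Finset.sum_le_sum_of_subset (Finset.range_subset_range.2 h)

/-- Expected discounted cost if the controller idles in state `x` until the next event and the
cost-to-go is `J` from then on. -/
noncomputable def Params.idleCost (J : State → ℝ≥0∞) (x : State) : ℝ≥0∞ :=
  x.jobs * ENNReal.ofReal (1 / (β + P.exitRate x))
    + (ENNReal.ofReal (P.rate x .arrival / (β + P.exitRate x)) * J (Event.arrival.next x)
    + ENNReal.ofReal (P.rate x .localDone / (β + P.exitRate x)) * J (Event.localDone.next x)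
    + ENNReal.ofReal (P.rate x .cloudSM1Done / (β + P.exitRate x)) * J (Event.cloudSM1Done.next x)
    + ENNReal.ofReal (P.rate x .cloudSM2Done / (β + P.exitRate x)) * J (Event.cloudSM2Done.next x))

theorem Params.lintegral_stayLaw {β : ℝ} (hβ : 0 < β) (J : State → ℝ≥0∞) (x : State) :
    ∫⁻ p, (x.jobs * ENNReal.ofReal ((1 - Real.exp (-β * p.1)) / β)
      + ENNReal.ofReal (Real.exp (-β * p.1)) * J (p.2.next x)) ∂P.stayLaw x =
      P.idleCost β J x := by
  have hr := P.exitRate_pos x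
  have := isProbabilityMeasure_expMeasure hr
  have hJ : Measurable fun e : Event => J (e.next x) := measurable_of_countable _
  have hexp : Measurable fun t : ℝ => ENNReal.ofReal (Real.exp (-β * t)) := by fun_prop
  have hI : Measurable fun t : ℝ => ENNReal.ofReal ((1 - Real.exp (-β * t)) / β) := by fun_prop
  rw [lintegral_add_left (by fun_prop), lintegral_const_mul _ (by fun_prop)]
  unfold stayLaw idleCost
  congr 1
  · rw [measurePreserving_fst.lintegral_comp hI, lintegral_discounted_stay hβ hr]
  · rw [lintegral_prod_mul hexp.aemeasurable hJ.aemeasurable, lintegral_exp_expMeasure hβ hr]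
    simp only [eventLaw, lintegral_add_measure, lintegral_smul_measure, lintegral_dirac,
      smul_eq_mul, mul_add, ← mul_assoc]
    have hmul (e : Event) : ENNReal.ofReal (P.exitRate x / (β + P.exitRate x)) *
        ENNReal.ofReal (P.rate x e / P.exitRate x) =
        ENNReal.ofReal (P.rate x e / (β + P.exitRate x)) := by
      rw [← ENNReal.ofReal_mul (by positivity)]
      congr 1
      field_simp
    simp only [hmul]

theorem measurable_sum_stayCost (N : ℕ) :
    Measurable fun p : State × Sample => ∑ k ∈ Finset.range N, stayCost π β p.1 p.2 k :=
  Finset.measurable_sum _ fun k _ => measurable_stayCost π β k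

/-- Discounted cost of the first `N + 1` stays if the first of them is spent in state `x`, as a
function of the first stage and of the later ones. -/
noncomputable def splitCost (N : ℕ) (x : State) (p : (State → ℝ × Event) × Sample) : ℝ≥0∞ :=
  x.jobs * ENNReal.ofReal ((1 - Real.exp (-β * (p.1 x).1)) / β)
    + ENNReal.ofReal (Real.exp (-β * (p.1 x).1)) *
      ∑ k ∈ Finset.range N, stayCost π β ((p.1 x).2.next x) p.2 k

theorem measurable_splitCost (N : ℕ) (x : State) : Measurable (splitCost π β N x) := by
  have hnext : Measurable fun e : Event => e.next x := measurable_of_countable _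
  have hx : Measurable fun p : (State → ℝ × Event) × Sample => p.1 x :=
    (measurable_pi_apply x).comp measurable_fst
  have h1 : Measurable fun p : (State → ℝ × Event) × Sample => ((p.1 x).2.next x, p.2) :=
    (hnext.comp hx.snd).prodMk measurable_snd
  have h2 := (measurable_sum_stayCost π β N).comp h1
  have h3 := hx.fst
  unfold splitCost
  exact (Measurable.const_mul (by fun_prop) _).add (Measurable.mul (by fun_prop) h2)

theorem sum_stayCost_succ (N : ℕ) (s : State) (ω : Sample) :
    ∑ k ∈ Finset.range (N + 1), stayCost π β s ω k =
      splitCost π β N (π.settle s) (ω 0, fun k => ω (k + 1)) := by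
  rw [Finset.sum_range_succ', add_comm, splitCost]
  congr 1
  · simp [stayCost, chain, jumpTime]
  · rw [Finset.mul_sum]
    exact Finset.sum_congr rfl fun k _ => stayCost_succ π β s ω k

theorem Params.lintegral_splitCost (N : ℕ) (x : State) (a : State → ℝ × Event) :
    ∫⁻ ω, splitCost π β N x (a, ω) ∂P.sampleLaw =
      x.jobs * ENNReal.ofReal ((1 - Real.exp (-β * (a x).1)) / β)
      + ENNReal.ofReal (Real.exp (-β * (a x).1)) * P.partialCost π β N ((a x).2.next x) := by
  have h := (measurable_sum_stayCost π β N).comp (measurable_const_pair ((a x).2.next x))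
  simp only [Function.comp_def] at h
  simp only [splitCost]
  rw [lintegral_add_left measurable_const, lintegral_const, measure_univ, mul_one,
    lintegral_const_mul _ h]
  rfl

/-- Strong Markov property at the first event: the first stage is independent of the later ones, and
the process restarts on the shifted sample. -/
theorem Params.partialCost_succ {β : ℝ} (hβ : 0 < β) (N : ℕ) (s : State) :
    P.partialCost π β (N + 1) s = P.idleCost β (P.partialCost π β N) (π.settle s) := by
  have hF := measurable_splitCost π β N (π.settle s)
  have hht : Measurable fun ω : Sample => (ω 0, fun k => ω (k + 1)) := by fun_prop
  have hcost : Measurable fun e : Event => P.partialCost π β N (e.next (π.settle s)) :=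
    measurable_of_countable _
  rw [partialCost]
  simp_rw [sum_stayCost_succ]
  rw [← lintegral_map hF hht, sampleLaw_eq, map_head_tail_infinitePi,
    lintegral_prod _ hF.aemeasurable, ← sampleLaw_eq, ← P.lintegral_stayLaw hβ]
  simp_rw [lintegral_splitCost]
  have h1 : Measurable fun p : ℝ × Event =>
      (π.settle s).jobs * ENNReal.ofReal ((1 - Real.exp (-β * p.1)) / β)
      + ENNReal.ofReal (Real.exp (-β * p.1)) *
        P.partialCost π β N (p.2.next (π.settle s)) :=
    (Measurable.const_mul (by fun_prop) _).add
      (Measurable.mul (by fun_prop) (hcost.comp measurable_snd))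
  exact (P.measurePreserving_stage (π.settle s)).lintegral_comp h1

end FirstStep

/-! ### The Bellman equation -/

theorem Action.Admissible.reach {a : Action} {s : State} (h : a.Admissible s) :
    Reach s (a.apply s) := by
  obtain ⟨n, j, i, m⟩ := s
  cases a with
  | idle => exact .refl _
  | SM1 =>
    obtain ⟨h1, rfl : i = false⟩ := h
    obtain ⟨k, rfl⟩ : ∃ k, n = k + 1 := ⟨n - 1, (Nat.sub_add_cancel h1).symm⟩
    exact .sm1 k j m
  | SM2 =>
    obtain ⟨h1, rfl : j = false⟩ := h
    obtain ⟨k, rfl⟩ : ∃ k, n = k + 1 := ⟨n - 1, (Nat.sub_add_cancel h1).symm⟩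
    exact .sm2 k i m

theorem Policy.reach_settle (π : Policy) (s : State) : Reach s (π.settle s) :=
  (π.admissible s).reach.trans (π.admissible (π.step s)).reach

/-! ### Greedy policies compatible with the SM1-first convention -/

section Greedy

variable {α : Type*} [LinearOrder α] (W : State → α)

/-- `u` minimizes `W` among the states that can be reached from `s` at once. -/
def MinimalFrom (s u : State) : Prop := ∀ t, Reach s t → W u ≤ W t

/-- The action `a` leads from `s` towards a minimizer of `W`, with a preference for `idle`, and
then for `SM1`. -/
def IsGreedy (s : State) : Action → Prop
  | .idle => MinimalFrom W s s
  | .SM1 => ∃ u, Reach (Action.SM1.apply s) u ∧ MinimalFrom W s u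
  | .SM2 => ∀ t, Reach s t → t ≠ Action.SM2.apply s → W (Action.SM2.apply s) < W t

theorem exists_isGreedy (s : State) : ∃ a : Action, a.Admissible s ∧ IsGreedy W s a := by
  have key (u : State) (hu : Reach s u) (hmin : MinimalFrom W s u)
      (hne : Action.SM2.Admissible s → u ≠ Action.SM2.apply s) :
      ∃ a : Action, a.Admissible s ∧ IsGreedy W s a := by
    cases hu with
    | refl => exact ⟨.idle, trivial, hmin⟩
    | sm1 n j m => exact ⟨.SM1, ⟨n.succ_pos, rfl⟩, _, .refl _, hmin⟩
    | sm2 n i m => exact absurd rfl (hne ⟨n.succ_pos, rfl⟩)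
    | both n m => exact ⟨.SM1, ⟨(n + 1).succ_pos, rfl⟩, _, .sm2 n true m, hmin⟩
  obtain ⟨u, hu, hmin⟩ := exists_reach_min W s
  by_cases h : Action.SM2.Admissible s ∧ u = Action.SM2.apply s
  · obtain ⟨hadm, rfl⟩ := h
    by_cases hg : IsGreedy W s .SM2
    · exact ⟨.SM2, hadm, hg⟩
    · simp only [IsGreedy, not_forall, not_lt] at hg
      obtain ⟨t, ht, hne, hle⟩ := hg
      exact key t ht (fun v hv => hle.trans (hmin v hv)) fun _ => hne
  · exact key u hu hmin fun hadm e => h ⟨hadm, e⟩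

theorem exists_policy_minimalFrom :
    ∃ π : Policy, ∀ s, MinimalFrom W s (π.settle s) := by
  choose act hadm hgr using exists_isGreedy W
  refine ⟨⟨act, hadm, fun s h1 h2 => ?_⟩, fun s => ?_⟩
  · have a1 := hadm s
    have g1 := hgr s
    have a2 := hadm (Action.SM2.apply s)
    have g2 := hgr (Action.SM2.apply s)
    rw [h1] at a1 g1
    rw [h2] at a2 g2
    obtain ⟨n, j, i, m⟩ := s
    obtain ⟨h3, rfl : j = false⟩ := a1
    obtain ⟨h4, rfl : i = false⟩ := a2
    obtain ⟨k, rfl⟩ : ∃ k, n = k + 2 := ⟨n - 2, by simp [Action.apply] at h3 h4; omega⟩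
    obtain ⟨u, hu, hmin⟩ := g2
    have hu' : u = ⟨k, true, true, m⟩ := by
      change Reach ⟨k, true, true, m⟩ u at hu
      cases hu
      rfl
    subst hu'
    -- SM2 is chosen only when its outcome is strictly better than every alternative, including
    -- filling both servers; a following SM1 would make that alternative minimal.
    have h5 := g1 _ (.both k m) (by simp [Action.apply])
    exact absurd (hmin _ (.refl _)) (not_le.2 h5)
  · set π : Policy := ⟨act, hadm, _⟩
    have hstep (s : State) : ∃ u, Reach (π.step s) u ∧ MinimalFrom W s u := by
      have g := hgr s
      change ∃ u, Reach ((act s).apply s) u ∧ _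
      cases ha : act s with
      | idle =>
        rw [ha] at g
        exact ⟨s, .refl s, g⟩
      | SM1 =>
        rw [ha] at g
        exact g
      | SM2 =>
        rw [ha] at g
        refine ⟨_, .refl _, fun t ht => ?_⟩
        by_cases e : t = Action.SM2.apply s
        · rw [e]
        · exact (g t ht e).le
    obtain ⟨u, hu, hmin⟩ := hstep s
    obtain ⟨v, hv, hmin'⟩ := hstep (π.step s)
    have g := hgr (π.settle s)
    rw [show act (π.settle s) = .idle from π.act_settle s] at g
    exact fun t ht => (g v hv).trans ((hmin' u hu).trans (hmin t ht))

end Greedy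

/-! ### One-step equation of the cost, policy improvement and linear growth -/

section Cost

variable (P : Params) {β : ℝ}

theorem Params.idleCost_mono {U J : State → ℝ≥0∞} (h : ∀ s, U s ≤ J s) (x : State) :
    P.idleCost β U x ≤ P.idleCost β J x := by
  unfold idleCost
  gcongr <;> exact h _

theorem Params.cost_eq_idleCost (hβ : 0 < β) (π : Policy) (s : State) :
    P.cost β s π = P.idleCost β (fun t => P.cost β t π) (π.settle s) := by
  have hlim (t : State) : Filter.Tendsto (fun N => P.partialCost π β N t) Filter.atTop
      (nhds (P.cost β t π)) := by
    rw [P.cost_eq_iSup π hβ]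
    exact tendsto_atTop_iSup fun M N h => P.partialCost_mono π β h t
  refine tendsto_nhds_unique ((Filter.tendsto_add_atTop_iff_nat 1).2 (hlim s)) ?_
  simp_rw [P.partialCost_succ π hβ]
  have hmul (c : ℝ) (t : State) : Filter.Tendsto
      (fun N => ENNReal.ofReal c * P.partialCost π β N t) Filter.atTop
      (nhds (ENNReal.ofReal c * P.cost β t π)) :=
    ENNReal.Tendsto.const_mul (hlim t) (Or.inr ENNReal.ofReal_ne_top)
  exact tendsto_const_nhds.add
    ((((hmul _ _).add (hmul _ _)).add (hmul _ _)).add (hmul _ _))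

/-- A supersolution of the one-step equation dominates every partial cost, by induction on the
number of stays. -/
theorem Params.cost_le (hβ : 0 < β) (π : Policy) {U : State → ℝ≥0∞}
    (hU : ∀ s, P.idleCost β U (π.settle s) ≤ U s) (s : State) : P.cost β s π ≤ U s := by
  rw [P.cost_eq_iSup π hβ]
  refine iSup_le fun N => ?_
  induction N generalizing s with
  | zero => simp [partialCost]
  | succ N ih =>
    rw [P.partialCost_succ π hβ]
    exact (P.idleCost_mono ih _).trans (hU s)

theorem Params.DelayOptimal.le_idleCost {P : Params} (hβ : 0 < β) {π : Policy}
    (hπ : P.DelayOptimal β π) {s t : State} (h : Reach s t) :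
    P.cost β s π ≤ P.idleCost β (fun u => P.cost β u π) t := by
  set W : State → ℝ≥0∞ := P.idleCost β fun u => P.cost β u π with hW
  obtain ⟨π', hπ'⟩ := exists_policy_minimalFrom W
  have h1 (s : State) : W (π'.settle s) ≤ P.cost β s π := by
    rw [P.cost_eq_idleCost hβ]
    exact hπ' s _ (π.reach_settle s)
  -- By `h1`, the one-step cost under `π'` is a supersolution for `π'`: this is policy improvement.
  have h2 : P.cost β s π' ≤ W (π'.settle s) :=
    P.cost_le hβ π' (U := fun s => W (π'.settle s)) (fun s => P.idleCost_mono h1 _) s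
  calc P.cost β s π = P.value β s := hπ s
    _ ≤ P.cost β s π' := iInf_le _ π'
    _ ≤ W (π'.settle s) := h2
    _ ≤ W t := hπ' s t h

/-- Real version of `Params.idleCost`. -/
noncomputable def Params.idleReal (P : Params) (β : ℝ) (V : State → ℝ) (x : State) : ℝ :=
  (x.jobs + (P.rate x .arrival * V (Event.arrival.next x)
    + P.rate x .localDone * V (Event.localDone.next x)
    + P.rate x .cloudSM1Done * V (Event.cloudSM1Done.next x)
    + P.rate x .cloudSM2Done * V (Event.cloudSM2Done.next x))) / (β + P.exitRate x)

theorem Params.idleCost_ofReal (hβ : 0 < β) {V : State → ℝ} (hV : ∀ s, 0 ≤ V s) (x : State) :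
    P.idleCost β (fun s => ENNReal.ofReal (V s)) x = ENNReal.ofReal (P.idleReal β V x) := by
  have hr := P.exitRate_pos x
  have hc : 0 < β + P.exitRate x := by positivity
  have h0 (e : Event) : 0 ≤ P.rate x e / (β + P.exitRate x) :=
    div_nonneg (P.rate_nonneg x e) hc.le
  have h1 (e : Event) : 0 ≤ P.rate x e / (β + P.exitRate x) * V (e.next x) :=
    mul_nonneg (h0 e) (hV _)
  unfold idleCost
  rw [← ENNReal.ofReal_mul (h0 _), ← ENNReal.ofReal_mul (h0 _), ← ENNReal.ofReal_mul (h0 _),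
    ← ENNReal.ofReal_mul (h0 _), ← ENNReal.ofReal_add (h1 _) (h1 _),
    ← ENNReal.ofReal_add (add_nonneg (h1 _) (h1 _)) (h1 _),
    ← ENNReal.ofReal_add (add_nonneg (add_nonneg (h1 _) (h1 _)) (h1 _)) (h1 _),
    ← ENNReal.ofReal_natCast, ← ENNReal.ofReal_mul (by positivity),
    ← ENNReal.ofReal_add (by positivity)
      (add_nonneg (add_nonneg (add_nonneg (h1 _) (h1 _)) (h1 _)) (h1 _))]
  congr 1
  unfold idleReal
  ring

/-- The bound is the cost if no job ever leaves, namely the discounted integral of `jobs + lam * t`;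
as a function of the state it is a supersolution for every policy. -/
theorem Params.cost_le_linear (hβ : 0 < β) (π : Policy) (s : State) :
    P.cost β s π ≤ ENNReal.ofReal (1 / β * (s.jobs + P.lam / β)) := by
  have hlam := P.lam_pos
  refine P.cost_le hβ π (U := fun s => ENNReal.ofReal (1 / β * (s.jobs + P.lam / β)))
    (fun s => ?_) s
  rw [P.idleCost_ofReal hβ (fun s => by positivity)]
  refine ENNReal.ofReal_le_ofReal ?_
  set x := π.settle s with hx
  rw [← (π.reach_settle s).jobs_eq, ← hx]
  have hr := P.exitRate_pos x
  have h0 (e : Event) (c : ℕ) (h : (e.next x).jobs ≤ x.jobs + c) :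
      P.rate x e * (1 / β * ((e.next x).jobs + P.lam / β)) ≤
        P.rate x e * (1 / β * (x.jobs + c + P.lam / β)) := by
    have : ((e.next x).jobs : ℝ) ≤ x.jobs + c := by exact_mod_cast h
    have := P.rate_nonneg x e
    gcongr
  have e1 := h0 .arrival 1 (jobs_arrival x).le
  have e2 := h0 .localDone 0 (jobs_localDone x).le
  have e3 := h0 .cloudSM1Done 0 (by simp [Event.next, State.jobs])
  have e4 := h0 .cloudSM2Done 0 (jobs_cloudSM2Done_le x)
  rw [show P.rate x .arrival = P.lam from rfl] at e1
  unfold idleReal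
  rw [div_le_iff₀ (by positivity), show P.rate x .arrival = P.lam from rfl]
  have h5 : 1 / β * (x.jobs + P.lam / β) * (β + P.exitRate x) =
      x.jobs + (P.lam * (1 / β * (x.jobs + 1 + P.lam / β))
        + P.rate x .localDone * (1 / β * (x.jobs + P.lam / β))
        + P.rate x .cloudSM1Done * (1 / β * (x.jobs + P.lam / β))
        + P.rate x .cloudSM2Done * (1 / β * (x.jobs + P.lam / β))) := by
    rw [exitRate, show P.rate x .arrival = P.lam from rfl]
    field_simp
    ring
  push_cast at e1 e2 e3 e4
  simp only [add_zero] at e2 e3 e4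
  linarith

/-- Uniformization: the flow exceeds the discounted value by the disadvantage of idling. -/
theorem Params.flow_eq (hβ : 0 < β) (V : State → ℝ) (x : State) :
    P.flow V x = P.clock β * V x + (β + P.exitRate x) * (P.idleReal β V x - V x) := by
  have hr := P.exitRate_pos x
  have hc : β + P.exitRate x ≠ 0 := by positivity
  rw [idleReal, mul_sub, mul_div_cancel₀ _ hc]
  obtain ⟨n, j, i, _ | m⟩ := x <;> cases j <;> cases i <;>
    simp [flow, clock, exitRate, rate, Event.next, cloudDone] <;> ring

end Cost

end Offloading

theorem mainTheorem1 (P : Offloading.Params) (hf : 1 / P.K < P.f) (β : ℝ) (hβ : 0 < β)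
    (π : Offloading.Policy) (hπ : P.DelayOptimal β π) : π.CloudFirst := by
  set V : Offloading.State → ℝ := fun s => (P.cost β s π).toReal with hV
  have hfin (s : Offloading.State) : P.cost β s π ≠ ⊤ :=
    ne_top_of_le_ne_top ENNReal.ofReal_ne_top (P.cost_le_linear hβ π s)
  have hVcost (s : Offloading.State) : ENNReal.ofReal (V s) = P.cost β s π :=
    ENNReal.ofReal_toReal (hfin s)
  have hV0 (s : Offloading.State) : 0 ≤ V s := ENNReal.toReal_nonneg
  have hidle (x : Offloading.State) :
      P.idleCost β (fun s => P.cost β s π) x = ENNReal.ofReal (P.idleReal β V x) := by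
    rw [← P.idleCost_ofReal hβ hV0]
    simp_rw [hVcost]
  have hidle0 (x : Offloading.State) : 0 ≤ P.idleReal β V x := by
    have hr (e : Offloading.Event) := P.rate_nonneg x e
    have := P.exitRate_pos x
    exact div_nonneg (add_nonneg (Nat.cast_nonneg _) (add_nonneg (add_nonneg (add_nonneg
      (mul_nonneg (hr _) (hV0 _)) (mul_nonneg (hr _) (hV0 _))) (mul_nonneg (hr _) (hV0 _)))
      (mul_nonneg (hr _) (hV0 _)))) (by positivity)
  have hle {s t : Offloading.State} (h : Offloading.Reach s t) : V s ≤ P.idleReal β V t := by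
    have := hπ.le_idleCost hβ h
    rw [hidle, ← hVcost] at this
    exact (ENNReal.ofReal_le_ofReal_iff (hidle0 t)).1 this
  have heq (s : Offloading.State) : V s = P.idleReal β V (π.settle s) := by
    have := P.cost_eq_idleCost hβ π s
    rw [hidle, ← hVcost] at this
    exact (ENNReal.ofReal_eq_ofReal_iff (hV0 s) (hidle0 _)).1 this
  have hmono {s t : Offloading.State} (h : Offloading.Reach s t) : V s ≤ V t := by
    rw [heq t]
    exact hle (h.trans (π.reach_settle t))
  have hsettle (s : Offloading.State) : P.clock β * V s = P.flow V (π.settle s) := by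
    -- At a settled state idling has no disadvantage, so the correction term of uniformization
    -- vanishes and the minimum is attained.
    have h1 : V (π.settle s) = V s :=
      le_antisymm ((hle (.refl _)).trans (heq s).ge) (hmono (π.reach_settle s))
    rw [P.flow_eq hβ, h1, ← heq s, sub_self, mul_zero, add_zero]
  have hB : P.BellmanStep β V V := by
    refine ⟨fun {s t} h => ?_, fun s => ⟨π.settle s, π.reach_settle s, hsettle s⟩⟩
    have h1 := mul_le_mul_of_nonneg_left (hmono h) (P.clock_pos hβ).le
    have h2 : 0 ≤ (β + P.exitRate t) * (P.idleReal β V t - V t) := by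
      have := P.exitRate_pos t
      exact mul_nonneg (by positivity) (sub_nonneg.2 (hle (.refl t)))
    rw [P.flow_eq hβ]
    linarith
  have hlam := P.lam_pos
  refine hB.cloudFirst hβ hf ?_ π hsettle
  refine hB.ordered hβ hf hV0 (c := 1 / β) (by positivity) fun s => ?_
  have h1 := ENNReal.toReal_le_of_le_ofReal (by positivity) (P.cost_le_linear hβ π s)
  refine h1.trans (mul_le_mul_of_nonneg_left ?_ (by positivity))
  have : 0 < P.lam / β := by positivity
  rw [mul_div_assoc]
  linarith
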